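/- A two-way nondeterministic finite automaton (2NFA) over a finite alphabet $\Sigma$ has a finite set of states $Q$, a set of initial states $Q_0 \subseteq Q$, a set of accepting states $F \subseteq Q$, and a transition function $\delta \colon Q \times (\Sigma \cup \{\vdash, \dashv\}) \to \mathcal{P}(Q \times \{-1,+1\})$, where $\vdash, \dashv \notin \Sigma$ are end-markers and $\delta(q, \dashv) = \emptyset$ for all $q \in F$. On an input $w = a_1 \ldots a_\ell \in \Sigma^*$, with $a_0 = {\vdash}$ and $a_{\ell+1} = {\dashv}$, a computation is a maximal (finite or infinite) sequence of pairs $(p_i, k_i)$ with $p_i \in Q$ and $0 \leqslant k_i \leqslant \ell+1$, such that $p_0 \in Q_0$, $k_0 = 0$, and $(p_{i+1}, k_{i+1} - k_i) \in \delta(p_i, a_{k_i})$ for all $i$. It is accepting if it is finite and its last pair $(p, k)$ satisfies $p \in F$ and $k = \ell+1$. The language recognized by the 2NFA is the set of strings on which it has at least one accepting computation. Theorem. Let $\mathcal{A}$ be a 2NFA with $n$ states over an alphabet $\Sigma$, and let $L$ be the language it recognizes. Let $X = \{x_1, \dots, x_\ell\}$ and $Y = \{y_1, \dots, y_m\}$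 be finite sets of strings over $\Sigma$. Let $M$ be the $\ell \times m$ matrix defined by $M_{i,j} = 1$ if $x_i y_j \in L$, and $M_{i,j} = 0$ otherwise. Then $$\operatorname{rank} M \leqslant \sum_{k=1}^{n} (k-1)!\, k!\, S(n,k)\, S(n+1,k),$$ where the rank is taken over $\mathbb{Q}$ and $S(\cdot,\cdot)$ denotes the Stirling numbers of the second kind. -/

import Mathlib

/-- Tape symbols: the letters of the alphabet `α` together with two fresh end-markers. -/
inductive TapeSymbol (α : Type*) where
  | leftEnd : TapeSymbol α
  | letter (a : α) : TapeSymbol α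
  | rightEnd : TapeSymbol α

/-- Head moves: `left` is `-1`, `right` is `+1`. -/
inductive HeadMove where
  | left : HeadMove
  | right : HeadMove

/-- The displacement of the head. -/
def HeadMove.toInt : HeadMove → ℤ
  | HeadMove.left => -1
  | HeadMove.right => 1

/-- Two-way nondeterministic finite automata over the alphabet `α` with set of states `Q`.
Accepting states are effective at the right end-marker, where they have no transitions. -/
structure TwoWayNFA (α Q : Type*) where
  start : Set Q
  step : Q → TapeSymbol α → Set (Q × HeadMove)
  accept : Set Q
  step_accept : ∀ q ∈ accept, step q TapeSymbol.rightEnd = ∅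

/-- The input string `w = a₁ … a_ℓ` delimited by the end-markers; position `0` holds the left
end-marker, position `i` holds `a_i`, and position `ℓ + 1` holds the right end-marker. -/
def delimitedTape {α : Type*} (w : List α) : List (TapeSymbol α) :=
  TapeSymbol.leftEnd :: (w.map TapeSymbol.letter ++ [TapeSymbol.rightEnd])

namespace TwoWayNFA

/-- One step between configurations (state, head position) on the input `w`;
the head never leaves the delimited tape. -/
def StepRel {α Q : Type*} (A : TwoWayNFA α Q) (w : List α) (c d : Q × ℕ) : Prop :=
  ∃ (a : TapeSymbol α) (m : HeadMove),
    (delimitedTape w)[c.2]? = some a ∧ (d.1, m) ∈ A.step c.1 a ∧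
      (d.2 : ℤ) = (c.2 : ℤ) + m.toInt ∧ d.2 ≤ w.length + 1

/-- A finite computation with `t` steps that is accepting: it starts in an initial
configuration, follows the transitions, is maximal, and its last configuration is an accepting
state at the right end-marker. -/
structure IsAcceptingComputation {α Q : Type*} (A : TwoWayNFA α Q) (w : List α) (t : ℕ)
    (c : Fin (t + 1) → Q × ℕ) : Prop where
  start_mem : (c 0).1 ∈ A.start
  start_pos : (c 0).2 = 0
  step_rel : ∀ i : Fin t, A.StepRel w (c i.castSucc) (c i.succ)
  maximal : ∀ d : Q × ℕ, ¬ A.StepRel w (c (Fin.last t)) d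
  accept_mem : (c (Fin.last t)).1 ∈ A.accept
  accept_pos : (c (Fin.last t)).2 = w.length + 1

/-- The language recognized by the automaton. -/
def language {α Q : Type*} (A : TwoWayNFA α Q) : Language α :=
  {w | ∃ (t : ℕ) (c : Fin (t + 1) → Q × ℕ), A.IsAcceptingComputation w t c}

end TwoWayNFA

open Classical in
/-- The 0/1 matrix whose entry at `(i, j)` is `1` exactly when `x_i y_j ∈ L`. -/
noncomputable def concatMatrix {α : Type*} (L : Language α) {l m : ℕ}
    (x : Fin l → List α) (y : Fin m → List α) : Matrix (Fin l) (Fin m) ℚ :=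
  Matrix.of fun i j => if x i ++ y j ∈ L then 1 else 0

/-! Cut the run on `x ++ y` at the border between `x` and `y`. The prefix matters only through `W`
(states of a first crossing to the right) and `N` (returns from the prefix); the suffix only through
`T` (acceptance without returning) and `P` (returns to the prefix). The word is accepted iff some
`crossingLayer` meets `T` (`exists_accepting_run_iff`).

Let `m` be the first such layer. Let `b r` be the first layer containing `r`, or `m + 1` if there is
none up to `m`; let `a q` be one plus the first layer before `m` whose states can return in `q`, or
`0` if there is none. On accepted words `(m, a, b)` is the unique triple compatible with both sides;
on rejected words there is none. Compatibility is a conjunction of a prefix and a suffix condition,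
so the matrix is a sum of rank-one terms (`indicator_eq_sum_labels`). The values `0, …, m` of `b`
all occur, hence `m < n`.

Only surjective `a` are needed (`prefixVector_mem_span`). If `a` misses a nonzero value, its prefix
vector vanishes. If it misses `0`, inclusion–exclusion expresses its vector through labels attaining
`0`, because when `W` is nonempty some `q` has `N q ⊆ W` and can be relabelled `0` freely. Counting
the remaining pairs `(a, b)` gives the bound. -/

/-! ### Counting labellings by Stirling numbers. -/

section SurjectionCount

open Finset

/-- The number of functions with a prescribed image of `k` elements is at most `k! S(n, k)`. -/
theorem card_filter_image_fin_le {β : Type*} [Fintype β] [DecidableEq β] (n : ℕ) (s : Finset β) :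
    #{f : Fin n → β | univ.image f = s} ≤ (#s).factorial * Nat.stirlingSecond n #s := by
  induction n generalizing s with
  | zero =>
    rcases s.eq_empty_or_nonempty with rfl | hs
    · simp
    · have : ({f : Fin 0 → β | univ.image f = s} : Finset _) = ∅ := by
        ext f
        simp [hs.ne_empty.symm]
      rw [this, card_empty]
      exact Nat.zero_le _
  | succ n ih =>
    have hsub : ({f : Fin (n + 1) → β | univ.image f = s} : Finset _) ⊆
        s.biUnion fun x =>
          (({f : Fin n → β | univ.image f = s} : Finset _) ∪
            ({f : Fin n → β | univ.image f = s.erase x} : Finset _)).image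
              fun f => (Fin.cons x f : Fin (n + 1) → β) := by
      intro f hf
      simp only [mem_filter, mem_univ, true_and] at hf
      have hins : s = insert (f 0) (univ.image (Fin.tail f)) := by
        rw [← hf]
        ext y
        simp [Fin.exists_fin_succ, Fin.tail, eq_comm]
      simp only [mem_biUnion, mem_image, mem_union, mem_filter, mem_univ, true_and]
      refine ⟨f 0, by rw [hins]; simp, Fin.tail f, ?_, Fin.cons_self_tail f⟩
      -- Either `f 0` recurs in the tail or it does not: the two terms of the Stirling recurrence.
      by_cases h0 : f 0 ∈ univ.image (Fin.tail f)
      · left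
        rw [hins, insert_eq_of_mem h0]
      · right
        rw [hins, erase_insert h0]
    refine (card_le_card hsub).trans (card_biUnion_le.trans ?_)
    rcases s.eq_empty_or_nonempty with rfl | hs
    · simp
    obtain ⟨k, hk⟩ : ∃ k, #s = k + 1 := ⟨#s - 1, by have := hs.card_pos; omega⟩
    have hterm : ∀ x ∈ s,
        #((({f : Fin n → β | univ.image f = s} : Finset _) ∪
          ({f : Fin n → β | univ.image f = s.erase x} : Finset _)).image
            fun f => (Fin.cons x f : Fin (n + 1) → β)) ≤
        (k + 1).factorial * Nat.stirlingSecond n (k + 1) +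
          k.factorial * Nat.stirlingSecond n k := by
      intro x hx
      have h1 := ih s
      have h2 := ih (s.erase x)
      rw [card_erase_of_mem hx, hk, Nat.add_sub_cancel] at h2
      rw [hk] at h1
      exact card_image_le.trans ((card_union_le _ _).trans (add_le_add h1 h2))
    refine (sum_le_card_nsmul _ _ _ hterm).trans (le_of_eq ?_)
    rw [hk, Nat.stirlingSecond_succ_succ, Nat.factorial_succ]
    simp only [smul_eq_mul]
    ring

theorem card_filter_image_le {Q β : Type*} [Fintype Q] [DecidableEq Q] [Fintype β] [DecidableEq β]
    (s : Finset β) :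
    #{f : Q → β | univ.image f = s} ≤
      (#s).factorial * Nat.stirlingSecond (Fintype.card Q) #s := by
  let e := Fintype.equivFin Q
  refine le_trans (card_le_card_of_injOn (fun f => f ∘ e.symm) ?_ ?_)
    (card_filter_image_fin_le (Fintype.card Q) s)
  · intro f hf
    simp only [coe_filter, mem_univ, true_and, Set.mem_ofPred_eq] at hf ⊢
    rw [← hf]
    ext y
    simp only [mem_image, mem_univ, true_and, Function.comp]
    exact ⟨fun ⟨i, hi⟩ => ⟨_, hi⟩, fun ⟨q, hq⟩ => ⟨e q, by simpa using hq⟩⟩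
  · intro f _ g _ h
    exact e.symm.surjective.injective_comp_right h

theorem card_surjective_le {Q : Type*} [Fintype Q] [DecidableEq Q] (k : ℕ) :
    Fintype.card {f : Q → Fin k // Function.Surjective f} ≤
      k.factorial * Nat.stirlingSecond (Fintype.card Q) k := by
  have h := card_filter_image_le (Q := Q) (univ : Finset (Fin k))
  rw [card_univ, Fintype.card_fin] at h
  refine le_trans (le_of_eq ?_) h
  rw [Fintype.card_subtype]
  congr 1
  ext f
  rw [mem_filter, mem_filter, Finset.eq_univ_iff_forall]
  simp [Function.Surjective]

/-- Counting the labellings in which every label except possibly the last one occurs. -/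
theorem card_almost_surjective_le {Q : Type*} [Fintype Q] [DecidableEq Q] (m : ℕ) :
    Fintype.card {f : Q → Fin (m + 2) // ∀ i ≤ m, ∃ r, (f r : ℕ) = i} ≤
      (m + 2).factorial * Nat.stirlingSecond (Fintype.card Q) (m + 2) +
        (m + 1).factorial * Nat.stirlingSecond (Fintype.card Q) (m + 1) := by
  have h1 := card_filter_image_le (Q := Q) (univ : Finset (Fin (m + 2)))
  have h2 := card_filter_image_le (Q := Q) ((univ : Finset (Fin (m + 2))).erase (Fin.last _))
  rw [card_univ, Fintype.card_fin] at h1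
  rw [card_erase_of_mem (mem_univ _), card_univ, Fintype.card_fin,
    show m + 2 - 1 = m + 1 from rfl] at h2
  rw [Fintype.card_subtype]
  refine le_trans (card_le_card ?_) ((card_union_le _ _).trans (add_le_add h1 h2))
  intro f hf
  simp only [mem_union, mem_filter, mem_univ, true_and] at hf ⊢
  by_cases hl : Fin.last _ ∈ univ.image f
  · left
    ext j
    refine ⟨fun _ => mem_univ _, fun _ => ?_⟩
    by_cases hj : j = Fin.last _
    · exact hj ▸ hl
    · obtain ⟨r, hr⟩ := hf j (by have := Fin.val_lt_last hj; omega)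
      exact mem_image.2 ⟨r, mem_univ _, Fin.ext hr⟩
  · right
    ext j
    rw [mem_erase]
    refine ⟨fun h => ⟨fun hj => hl (hj ▸ h), mem_univ _⟩, fun ⟨hj, _⟩ => ?_⟩
    obtain ⟨r, hr⟩ := hf j (by have := Fin.val_lt_last hj; omega)
    exact mem_image.2 ⟨r, mem_univ _, Fin.ext hr⟩

/-- With `g k = k! S(n, k)`, the recurrence for `S(n + 1, k)` turns the right-hand summand into `g
(k - 1) * g k + g k * g k`. The mixed products agree with those on the left after an index shift,
since `g (n + 1) = 0`. -/
theorem sum_factorial_stirlingSecond_le (n : ℕ) :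
    ∑ m ∈ range n, ((m + 1).factorial * Nat.stirlingSecond n (m + 1)) *
        ((m + 2).factorial * Nat.stirlingSecond n (m + 2) +
          (m + 1).factorial * Nat.stirlingSecond n (m + 1)) ≤
      ∑ k ∈ Icc 1 n, (k - 1).factorial * k.factorial * Nat.stirlingSecond n k *
        Nat.stirlingSecond (n + 1) k := by
  set g : ℕ → ℕ := fun k => k.factorial * Nat.stirlingSecond n k with hg
  have hR : ∑ k ∈ Icc 1 n, (k - 1).factorial * k.factorial * Nat.stirlingSecond n k *
        Nat.stirlingSecond (n + 1) k =
      ∑ m ∈ range n, (g m * g (m + 1) + g (m + 1) * g (m + 1)) := by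
    rw [← Finset.Ico_add_one_right_eq_Icc, Finset.sum_Ico_eq_sum_range]
    refine sum_congr rfl fun m _ => ?_
    rw [add_comm 1 m, Nat.add_sub_cancel, Nat.stirlingSecond_succ_succ]
    simp only [hg, Nat.factorial_succ]
    ring
  have hL : ∑ m ∈ range n, g (m + 1) * (g (m + 2) + g (m + 1)) =
      ∑ m ∈ range n, g (m + 1) * g (m + 2) + ∑ m ∈ range n, g (m + 1) * g (m + 1) := by
    rw [← sum_add_distrib]
    exact sum_congr rfl fun m _ => mul_add _ _ _
  have hlast : g (n + 1) = 0 := by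
    simp [hg, Nat.stirlingSecond_eq_zero_of_lt (Nat.lt_succ_self n)]
  have hshift := (sum_range_succ' (fun m => g m * g (m + 1)) n).symm.trans
    (sum_range_succ (fun m => g m * g (m + 1)) n)
  rw [hlast, mul_zero, add_zero] at hshift
  change ∑ m ∈ range n, g (m + 1) * (g (m + 2) + g (m + 1)) ≤ _
  rw [hR, hL, sum_add_distrib, ← hshift]
  exact Nat.add_le_add_right (Nat.le_add_right _ _) _

end SurjectionCount

/-! ### Layers of border crossings and their labellings. -/

section Layers

variable {Q : Type*}

/-- The states in which the boundary can be crossed rightwards after at most `i` returns: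
`W` are the initial crossings, `P` the leftward returns and `N` the further rightward crossings. -/
def crossingLayer (W : Set Q) (N P : Q → Set Q) : ℕ → Set Q
  | 0 => W
  | i + 1 => W ∪ {r | ∃ q, (∃ p ∈ crossingLayer W N P i, q ∈ P p) ∧ r ∈ N q}

theorem crossingLayer_subset_succ (W : Set Q) (N P : Q → Set Q) (i : ℕ) :
    crossingLayer W N P i ⊆ crossingLayer W N P (i + 1) := by
  induction i with
  | zero => exact Set.subset_union_left
  | succ i ih =>
    rintro r (hr | ⟨q, ⟨p, hp, hq⟩, hr⟩)
    · exact Or.inl hr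
    · exact Or.inr ⟨q, ⟨p, ih hp, hq⟩, hr⟩

theorem crossingLayer_mono (W : Set Q) (N P : Q → Set Q) : Monotone (crossingLayer W N P) :=
  monotone_nat_of_le_succ (crossingLayer_subset_succ W N P)

theorem crossingLayer_eq_of_stable {W : Set Q} {N P : Q → Set Q} {i : ℕ}
    (h : crossingLayer W N P (i + 1) = crossingLayer W N P i) {j : ℕ} (hj : i ≤ j) :
    crossingLayer W N P j = crossingLayer W N P i := by
  induction j, hj using Nat.le_induction with
  | base => rfl
  | succ j _ ih =>
    rw [← h]
    simp only [crossingLayer, ih]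

/-- The labels `a`, `b` describe the cumulative rightward crossings, as far as the prefix data
`W`, `N` are concerned. A label `a q = 0` means that `q` is not used. -/
def PrefixLabelled (m : ℕ) (a b : Q → ℕ) (W : Set Q) (N : Q → Set Q) : Prop :=
  ∀ i ≤ m, ∀ r, b r ≤ i ↔ r ∈ W ∨ ∃ q, (1 ≤ a q ∧ a q ≤ i) ∧ r ∈ N q

/-- The labels `a`, `b` describe the cumulative leftward crossings, as far as the suffix data
`T`, `P` are concerned, and acceptance happens first at layer `m`. -/
def SuffixLabelled (m : ℕ) (a b : Q → ℕ) (T : Set Q) (P : Q → Set Q) : Prop :=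
  (∀ i < m, ∀ q, (1 ≤ a q ∧ a q ≤ i + 1) ↔ ∃ r, b r ≤ i ∧ q ∈ P r) ∧
    (∀ r, b r < m → r ∉ T) ∧ ∃ r, b r ≤ m ∧ r ∈ T

/-- The two conditions determine the labels alternately: `b` up to `i` fixes `a` up to `i + 1`,
which fixes `b` up to `i + 1`. This forces compatible labels to be the first-occurrence times. -/
theorem label_le_iff_mem_crossingLayer {m : ℕ} {a b : Q → ℕ} {W T : Set Q} {N P : Q → Set Q}
    (hu : PrefixLabelled m a b W N) (hv : SuffixLabelled m a b T P) {i : ℕ} (hi : i ≤ m) (r : Q) :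
    b r ≤ i ↔ r ∈ crossingLayer W N P i := by
  induction i generalizing r with
  | zero =>
    rw [hu 0 hi r, crossingLayer]
    refine or_iff_left ?_
    rintro ⟨q, ⟨h1, h2⟩, _⟩
    omega
  | succ i ih =>
    rw [hu (i + 1) hi r, crossingLayer]
    refine or_congr Iff.rfl (exists_congr fun q => and_congr ?_ Iff.rfl)
    rw [hv.1 i hi q]
    exact exists_congr fun p => and_congr (ih (by omega) p) Iff.rfl

theorem level_isLeast {m : ℕ} {a b : Q → ℕ} {W T : Set Q} {N P : Q → Set Q}
    (hu : PrefixLabelled m a b W N) (hv : SuffixLabelled m a b T P) :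
    IsLeast {i | ∃ r ∈ crossingLayer W N P i, r ∈ T} m := by
  constructor
  · obtain ⟨r, hr, hT⟩ := hv.2.2
    exact ⟨r, (label_le_iff_mem_crossingLayer hu hv le_rfl r).1 hr, hT⟩
  · rintro i ⟨r, hr, hT⟩
    by_contra! hlt
    exact hv.2.1 r (((label_le_iff_mem_crossingLayer hu hv hlt.le r).2 hr).trans_lt hlt) hT

theorem right_label_unique {m : ℕ} {a b a' b' : Q → ℕ} {W T : Set Q} {N P : Q → Set Q}
    (hu : PrefixLabelled m a b W N) (hv : SuffixLabelled m a b T P)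
    (hu' : PrefixLabelled m a' b' W N) (hv' : SuffixLabelled m a' b' T P)
    (hb : ∀ r, b r ≤ m + 1) (hb' : ∀ r, b' r ≤ m + 1) (r : Q) : b r = b' r := by
  have key : ∀ i ≤ m, b r ≤ i ↔ b' r ≤ i := fun i hi =>
    (label_le_iff_mem_crossingLayer hu hv hi r).trans
      (label_le_iff_mem_crossingLayer hu' hv' hi r).symm
  have := hb r
  have := hb' r
  by_contra hne
  rcases Nat.lt_or_gt_of_ne hne with h | h
  · have := (key (b r) (by omega)).1 le_rfl
    omega
  · have := (key (b' r) (by omega)).2 le_rfl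
    omega

theorem left_label_unique {m : ℕ} {a b a' : Q → ℕ} {T : Set Q} {P : Q → Set Q}
    (hv : SuffixLabelled m a b T P) (hv' : SuffixLabelled m a' b T P)
    (ha : ∀ q, a q ≤ m) (ha' : ∀ q, a' q ≤ m) (q : Q) : a q = a' q := by
  have key : ∀ i < m, (1 ≤ a q ∧ a q ≤ i + 1) ↔ (1 ≤ a' q ∧ a' q ≤ i + 1) := fun i hi =>
    (hv.1 i hi q).trans (hv'.1 i hi q).symm
  have h1 := ha q
  have h2 := ha' q
  by_contra hne
  by_cases h : 1 ≤ a q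
  · have h3 := (key (a q - 1) (by omega)).1 (by omega)
    have h4 := (key (a' q - 1) (by omega)).2 (by omega)
    omega
  · have h4 := (key (a' q - 1) (by omega)).2 (by omega)
    omega

theorem exists_level_function (m : ℕ) {S : ℕ → Set Q} (hS : Monotone S) :
    ∃ c : Q → ℕ, (∀ r, c r ≤ m) ∧ ∀ i < m, ∀ r, c r ≤ i ↔ r ∈ S i := by
  classical
  have h : ∀ r, ∃ c, c ≤ m ∧ ∀ i < m, c ≤ i ↔ r ∈ S i := by
    intro r
    by_cases hr : ∃ i, i < m ∧ r ∈ S i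
    · refine ⟨Nat.find hr, (Nat.find_spec hr).1.le, fun i hi => ⟨fun hle => ?_, fun hmem => ?_⟩⟩
      · exact hS hle (Nat.find_spec hr).2
      · exact Nat.find_min' hr ⟨hi, hmem⟩
    · refine ⟨m, le_rfl, fun i hi => ⟨fun hle => by omega, fun hmem => (hr ⟨i, hi, hmem⟩).elim⟩⟩
  choose c hc using h
  exact ⟨c, fun r => (hc r).1, fun i hi r => (hc r).2 i hi⟩

theorem exists_labels {W T : Set Q} {N P : Q → Set Q} {M : ℕ} {r₀ : Q}
    (hr₀ : r₀ ∈ crossingLayer W N P M) (hT : r₀ ∈ T) :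
    ∃ (m : ℕ) (a b : Q → ℕ), (∀ q, a q ≤ m) ∧ (∀ r, b r ≤ m + 1) ∧
      (∀ i ≤ m, ∃ r, b r = i) ∧ PrefixLabelled m a b W N ∧ SuffixLabelled m a b T P := by
  classical
  have hex : ∃ i, ∃ r ∈ crossingLayer W N P i, r ∈ T := ⟨M, r₀, hr₀, hT⟩
  obtain ⟨m, ⟨r₁, hr₁, hT₁⟩, hmin⟩ : ∃ m, (∃ r ∈ crossingLayer W N P m, r ∈ T) ∧
      ∀ i < m, ¬ ∃ r ∈ crossingLayer W N P i, r ∈ T :=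
    ⟨Nat.find hex, Nat.find_spec hex, fun i hi => Nat.find_min hex hi⟩
  obtain ⟨b, hbm, hb⟩ := exists_level_function (m + 1) (crossingLayer_mono W N P)
  obtain ⟨c, hcm, hc⟩ := exists_level_function m
    (S := fun i => {q | ∃ p ∈ crossingLayer W N P i, q ∈ P p})
    (fun i j hij q ⟨p, hp, hq⟩ => ⟨p, crossingLayer_mono W N P hij hp, hq⟩)
  -- `c q = m` means that `q` is not returned to from any layer before `m`; such states get the
  -- reserved label `0`, and the others are shifted by one.
  have hac : ∀ i < m, ∀ q, (1 ≤ (if c q = m then 0 else c q + 1) ∧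
      (if c q = m then 0 else c q + 1) ≤ i + 1) ↔ c q ≤ i := by
    intro i hi q
    split_ifs <;> omega
  refine ⟨m, fun q => if c q = m then 0 else c q + 1, b, ?_, hbm, ?_, ?_, ?_, ?_, ?_⟩
  · intro q
    have := hcm q
    dsimp only
    split_ifs <;> omega
  -- A skipped value would mean that the layers have stopped growing, so `T` would be met earlier
  -- or, if value `0` is skipped, never.
  · intro i hi
    by_contra! hne
    rcases i with _ | i
    · have h0 : crossingLayer W N P 0 = ∅ := by
        ext r
        rw [← hb 0 (by omega) r]
        have := hne r
        simp only [Set.mem_empty_iff_false, iff_false]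
        omega
      have h1 : crossingLayer W N P 1 = crossingLayer W N P 0 := by
        have hW : W = ∅ := h0
        simp [crossingLayer, hW]
      rw [crossingLayer_eq_of_stable h1 (Nat.zero_le m), h0] at hr₁
      exact hr₁
    · have h1 : crossingLayer W N P (i + 1) = crossingLayer W N P i := by
        ext r
        rw [← hb (i + 1) (by omega) r, ← hb i (by omega) r]
        have := hne r
        omega
      rw [crossingLayer_eq_of_stable h1 (by omega : i ≤ m)] at hr₁
      exact hmin i (by omega) ⟨r₁, hr₁, hT₁⟩
  · intro i hi r
    rw [hb i (by omega) r]
    rcases i with _ | i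
    · rw [crossingLayer]
      refine (or_iff_left ?_).symm
      rintro ⟨q, ⟨h1, h2⟩, _⟩
      omega
    · rw [crossingLayer]
      refine or_congr Iff.rfl (exists_congr fun q => and_congr ?_ Iff.rfl)
      rw [hac i (by omega) q, hc i (by omega) q]
      rfl
  · intro i hi q
    rw [hac i hi q, hc i hi q]
    exact exists_congr fun p => and_congr (hb i (by omega) p).symm Iff.rfl
  · intro r hr hrT
    exact hmin (b r) hr ⟨r, (hb (b r) (by omega) r).1 le_rfl, hrT⟩
  · exact ⟨r₁, (hb m (by omega) r₁).2 hr₁, hT₁⟩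

/-- A state first crossing at layer `j > 0` must come from a return labelled exactly `j`; an earlier
one would have produced it sooner. -/
theorem PrefixLabelled.exists_left_label {m : ℕ} {a b : Q → ℕ} {W : Set Q} {N : Q → Set Q}
    (h : PrefixLabelled m a b W N) {j : ℕ} (hj : j ≠ 0) (hjm : j ≤ m) (hb : ∃ r, b r = j) :
    ∃ q, a q = j := by
  obtain ⟨r, hr⟩ := hb
  have hlt : ¬ b r ≤ j - 1 := by omega
  rw [h (j - 1) (by omega) r] at hlt
  rcases (h j hjm r).1 hr.le with hW | ⟨q, ⟨h1, h2⟩, hq⟩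
  · exact (hlt (Or.inl hW)).elim
  · refine ⟨q, ?_⟩
    by_contra hne
    exact hlt (Or.inr ⟨q, ⟨h1, by omega⟩, hq⟩)

/-- A state whose crossings all lie in `W` may be dropped from the labelling. -/
theorem prefixLabelled_congr_of_subset {m : ℕ} {a a' b : Q → ℕ} {W : Set Q} {N : Q → Set Q}
    {q₀ : Q} (hq₀ : N q₀ ⊆ W) (haa' : ∀ q ≠ q₀, a q = a' q) :
    PrefixLabelled m a b W N ↔ PrefixLabelled m a' b W N := by
  refine forall_congr' fun i => forall_congr' fun _ => forall_congr' fun r => iff_congr Iff.rfl ?_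
  by_cases hr : r ∈ W
  · simp [hr]
  · refine or_congr Iff.rfl (exists_congr fun q => ?_)
    by_cases hq : q = q₀
    · subst hq
      have : r ∉ N q := fun h => hr (hq₀ h)
      simp [this]
    · rw [haa' q hq]

end Layers

/-! ### Rank-one decomposition and reduction to surjective labels. -/

section RankBound

open Finset

/-- The indicator vector of the prefixes compatible with given labels. -/
noncomputable def prefixVector {ι Q : Type*} (W : ι → Set Q) (N : ι → Q → Set Q) (m : ℕ)
    (a : Q → Fin (m + 1)) (b : Q → Fin (m + 2)) : ι → ℚ :=
  open Classical in fun i =>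
    if PrefixLabelled m (fun q => a q) (fun r => b r) (W i) (N i) then 1 else 0

/-- The labels `b` in which every value except possibly the last one occurs. -/
abbrev RightLabel (Q : Type*) (m : ℕ) : Type _ :=
  {b : Q → Fin (m + 2) // ∀ i ≤ m, ∃ r, (b r : ℕ) = i}

/-- Labels `a` in which every value occurs. -/
abbrev LeftLabel (Q : Type*) (m : ℕ) : Type _ :=
  {a : Q → Fin (m + 1) // Function.Surjective a}

variable {ι Q : Type*}

theorem prefixVector_eq_zero_of_not_mem {W : ι → Set Q} {N : ι → Q → Set Q} {m : ℕ}
    {a : Q → Fin (m + 1)} (b : RightLabel Q m) {j : Fin (m + 1)} (hj : j ≠ 0)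
    (ha : ∀ q, a q ≠ j) : prefixVector W N m a b.1 = 0 := by
  ext i
  rw [prefixVector, if_neg, Pi.zero_apply]
  intro h
  obtain ⟨q, hq⟩ := h.exists_left_label (j := j) (Fin.val_ne_zero_iff.2 hj) (by omega)
    (b.2 j (by omega))
  exact ha q (Fin.ext hq)

variable [Fintype Q] [DecidableEq Q]

/-- In each coordinate with `W i` nonempty, toggling `q₀` in `D` flips the sign and keeps the entry,
so terms cancel in pairs. The state `q₀` depends on `i`, which is why `D` ranges over all subsets.
-/
theorem sum_erased_labels_eq_zero {W : ι → Set Q} {N : ι → Q → Set Q}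
    (hX : ∀ i, (W i).Nonempty → ∃ q, N i q ⊆ W i) (m : ℕ) (a : Q → Fin (m + 1))
    (b : RightLabel Q m) :
    ∑ D : Finset Q, (-1 : ℚ) ^ #D •
      prefixVector W N m (fun q => if q ∈ D then 0 else a q) b.1 = 0 := by
  ext i
  simp only [Finset.sum_apply, Pi.smul_apply, smul_eq_mul, Pi.zero_apply]
  rcases (W i).eq_empty_or_nonempty with hW | hW
  -- Some `b` value is `0`, which demands an element of `W i`; so every entry vanishes here.
  · refine sum_eq_zero fun D _ => ?_
    rw [prefixVector, if_neg, mul_zero]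
    intro h
    obtain ⟨r, hr⟩ := b.2 0 (Nat.zero_le _)
    rcases (h 0 (Nat.zero_le _) r).1 hr.le with h' | ⟨q, ⟨h1, h2⟩, _⟩
    · rw [hW] at h'
      exact h'
    · omega
  · obtain ⟨q₀, hq₀⟩ := hX i hW
    have huniv : (univ : Finset (Finset Q)) = (insert q₀ (univ.erase q₀)).powerset := by
      rw [insert_erase (mem_univ _), powerset_univ]
    rw [huniv, sum_powerset_insert (notMem_erase _ _), ← sum_add_distrib]
    refine sum_eq_zero fun D hD => ?_
    have hqD : q₀ ∉ D := fun h => notMem_erase q₀ univ (mem_powerset.1 hD h)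
    have hcongr : prefixVector W N m (fun q => if q ∈ insert q₀ D then 0 else a q) b.1 i =
        prefixVector W N m (fun q => if q ∈ D then 0 else a q) b.1 i := by
      classical
      refine if_congr (prefixLabelled_congr_of_subset hq₀ fun q hq => ?_) rfl rfl
      simp [hq]
    rw [hcongr, card_insert_of_notMem hqD, pow_succ]
    ring

/-- The vectors with surjective labels `a` span all of them. -/
theorem prefixVector_mem_span {W : ι → Set Q} {N : ι → Q → Set Q}
    (hX : ∀ i, (W i).Nonempty → ∃ q, N i q ⊆ W i) {n : ℕ} (m : Fin n) (a : Q → Fin (m + 1))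
    (b : RightLabel Q m) :
    prefixVector W N m a b.1 ∈ Submodule.span ℚ (Set.range
      fun σ : Σ m : Fin n, LeftLabel Q m × RightLabel Q m =>
        prefixVector W N σ.1 σ.2.1.1 σ.2.2.1) := by
  have hzero : ∀ a : Q → Fin (m + 1), (∃ q, a q = 0) →
      prefixVector W N m a b.1 ∈ Submodule.span ℚ (Set.range
        fun σ : Σ m : Fin n, LeftLabel Q m × RightLabel Q m =>
          prefixVector W N σ.1 σ.2.1.1 σ.2.2.1) := by
    intro a h0
    by_cases hs : Function.Surjective a
    · exact Submodule.subset_span ⟨⟨m, ⟨a, hs⟩, b⟩, rfl⟩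
    · obtain ⟨j, hj⟩ : ∃ j, ∀ q, a q ≠ j := by simpa [Function.Surjective] using hs
      rw [prefixVector_eq_zero_of_not_mem b (j := j) ?_ hj]
      · exact Submodule.zero_mem _
      · rintro rfl
        obtain ⟨q, hq⟩ := h0
        exact hj q hq
  have hsum := sum_erased_labels_eq_zero hX m a b
  -- The term `D = ∅` is the given vector; all others attain the label `0`.
  rw [← add_sum_erase _ _ (mem_univ (∅ : Finset Q))] at hsum
  simp only [card_empty, pow_zero, one_smul, notMem_empty, if_false] at hsum
  rw [eq_neg_of_add_eq_zero_left hsum]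
  refine Submodule.neg_mem _ (Submodule.sum_mem _ fun D hD => Submodule.smul_mem _ _ (hzero _ ?_))
  obtain ⟨q, hq⟩ := nonempty_iff_ne_empty.2 (ne_of_mem_erase hD)
  exact ⟨q, if_pos hq⟩

open Classical in
/-- The indicator of acceptance is a sum of rank-one terms, indexed by labels. -/
theorem indicator_eq_sum_labels (W T : Set Q) (N P : Q → Set Q) :
    (if ∃ M, ∃ r ∈ crossingLayer W N P M, r ∈ T then (1 : ℚ) else 0) =
      ∑ σ : Σ m : Fin (Fintype.card Q), (Q → Fin (m + 1)) × RightLabel Q m,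
        (if SuffixLabelled σ.1 (fun q => σ.2.1 q) (fun r => σ.2.2.1 r) T P then (1 : ℚ) else 0) *
        (if PrefixLabelled σ.1 (fun q => σ.2.1 q) (fun r => σ.2.2.1 r) W N then 1 else 0) := by
  split_ifs with h
  · obtain ⟨M, r₀, hr₀, hT⟩ := h
    obtain ⟨m, a, b, ha, hb, hhit, hu, hv⟩ := exists_labels hr₀ hT
    have hm : m < Fintype.card Q := by
      choose r hr using fun i : Fin (m + 1) => hhit i (by omega)
      have hinj : Function.Injective r := fun i j hij => Fin.ext (by rw [← hr i, ← hr j, hij])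
      simpa using Fintype.card_le_of_injective r hinj
    rw [sum_eq_single (⟨⟨m, hm⟩, fun q => ⟨a q, Nat.lt_succ_of_le (ha q)⟩,
      ⟨fun r => ⟨b r, Nat.lt_succ_of_le (hb r)⟩, hhit⟩⟩ :
        Σ m : Fin (Fintype.card Q), (Q → Fin (m + 1)) × RightLabel Q m)]
    · rw [if_pos hv, if_pos hu, mul_one]
    · rintro ⟨⟨m', hm'⟩, a', b'⟩ _ hne
      by_contra hmul
      have hv' := (ite_ne_right_iff.1 (left_ne_zero_of_mul hmul)).1
      have hu' := (ite_ne_right_iff.1 (right_ne_zero_of_mul hmul)).1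
      obtain rfl : m' = m := (level_isLeast hu' hv').unique (level_isLeast hu hv)
      have hbb : ∀ r, (b'.1 r : ℕ) = b r :=
        right_label_unique hu' hv' hu hv (fun r => Nat.le_of_lt_succ (b'.1 r).2) hb
      have hbf : (fun r => (b'.1 r : ℕ)) = b := funext hbb
      dsimp only at hv'
      rw [hbf] at hv'
      have haa : ∀ q, (a' q : ℕ) = a q := left_label_unique hv' hv (fun q => Nat.le_of_lt_succ (a' q).2) ha
      refine hne ?_
      congr 2
      · exact funext fun q => Fin.ext (haa q)
      · exact Subtype.ext (funext fun r => Fin.ext (hbb r))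
    · exact fun h => (h (mem_univ _)).elim
  · refine (sum_eq_zero fun σ _ => ?_).symm
    by_contra hmul
    have hv' := (ite_ne_right_iff.1 (left_ne_zero_of_mul hmul)).1
    have hu' := (ite_ne_right_iff.1 (right_ne_zero_of_mul hmul)).1
    exact h ⟨_, (level_isLeast hu' hv').1⟩

open Classical in
/-- The rank of a matrix whose entries record whether the crossings of a prefix and a suffix
connect. -/
theorem rank_crossing_matrix_le {κ : Type*} [Fintype ι] [Fintype κ]
    (W : ι → Set Q) (N : ι → Q → Set Q) (T : κ → Set Q) (P : κ → Q → Set Q)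
    (hX : ∀ i, (W i).Nonempty → ∃ q, N i q ⊆ W i) :
    (Matrix.of fun i j => if ∃ M, ∃ r ∈ crossingLayer (W i) (N i) (P j) M, r ∈ T j
      then (1 : ℚ) else 0).rank ≤
      ∑ k ∈ Icc 1 (Fintype.card Q), (k - 1).factorial * k.factorial *
        Nat.stirlingSecond (Fintype.card Q) k * Nat.stirlingSecond (Fintype.card Q + 1) k := by
  rw [Matrix.rank_eq_finrank_span_cols]
  have hle : Submodule.span ℚ (Set.range (Matrix.of fun i j =>
      if ∃ M, ∃ r ∈ crossingLayer (W i) (N i) (P j) M, r ∈ T j then (1 : ℚ) else 0).col) ≤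
      Submodule.span ℚ (Set.range
        fun σ : Σ m : Fin (Fintype.card Q), LeftLabel Q m × RightLabel Q m =>
          prefixVector W N σ.1 σ.2.1.1 σ.2.2.1) := by
    rw [Submodule.span_le]
    rintro _ ⟨j, rfl⟩
    have hcol : (Matrix.of fun i j =>
        if ∃ M, ∃ r ∈ crossingLayer (W i) (N i) (P j) M, r ∈ T j then (1 : ℚ) else 0).col j =
        ∑ σ : Σ m : Fin (Fintype.card Q), (Q → Fin (m + 1)) × RightLabel Q m,
          (if SuffixLabelled σ.1 (fun q => σ.2.1 q) (fun r => σ.2.2.1 r) (T j) (P j)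
            then (1 : ℚ) else 0) • prefixVector W N σ.1 σ.2.1 σ.2.2.1 := by
      ext i
      simp only [Finset.sum_apply, Pi.smul_apply, smul_eq_mul, prefixVector]
      exact indicator_eq_sum_labels (W i) (T j) (N i) (P j)
    rw [hcol]
    exact Submodule.sum_mem _ fun σ _ =>
      Submodule.smul_mem _ _ (prefixVector_mem_span hX σ.1 σ.2.1 σ.2.2)
  refine (Submodule.finrank_mono hle).trans ((finrank_range_le_card _).trans ?_)
  rw [Fintype.card_sigma]
  refine le_trans ?_ (sum_factorial_stirlingSecond_le (Fintype.card Q))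
  rw [← Fin.sum_univ_eq_sum_range (fun m =>
    ((m + 1).factorial * Nat.stirlingSecond (Fintype.card Q) (m + 1)) *
        ((m + 2).factorial * Nat.stirlingSecond (Fintype.card Q) (m + 2) +
          (m + 1).factorial * Nat.stirlingSecond (Fintype.card Q) (m + 1)))]
  refine sum_le_sum fun m _ => ?_
  rw [Fintype.card_prod]
  refine Nat.mul_le_mul ?_ ?_
  · convert card_surjective_le (Q := Q) (m + 1)
  · convert card_almost_surjective_le (Q := Q) m

end RankBound

/-! ### Splitting automaton runs at the border. -/

theorem HeadMove.toInt_le_one (m : HeadMove) : m.toInt ≤ 1 := by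
  cases m <;> simp [HeadMove.toInt]

theorem HeadMove.neg_one_le_toInt (m : HeadMove) : -1 ≤ m.toInt := by
  cases m <;> simp [HeadMove.toInt]

namespace TwoWayNFA

open Relation

variable {α Q : Type*}

/-- Steps of the automaton while the head is on the left end-marker or on the prefix `x`. -/
def PrefixStep (A : TwoWayNFA α Q) (x : List α) (c d : Q × ℕ) : Prop :=
  ∃ (a : TapeSymbol α) (m : HeadMove),
    (TapeSymbol.leftEnd :: x.map TapeSymbol.letter)[c.2]? = some a ∧
      (d.1, m) ∈ A.step c.1 a ∧ (d.2 : ℤ) = (c.2 : ℤ) + m.toInt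

/-- Steps of the automaton while the head is on the suffix `y` or on the right end-marker.
Positions are shifted so that the suffix starts at position `1`. -/
def SuffixStep (A : TwoWayNFA α Q) (y : List α) (c d : Q × ℕ) : Prop :=
  ∃ (p : ℕ) (a : TapeSymbol α) (m : HeadMove), c.2 = p + 1 ∧
    (y.map TapeSymbol.letter ++ [TapeSymbol.rightEnd])[p]? = some a ∧
      (d.1, m) ∈ A.step c.1 a ∧ (d.2 : ℤ) = (c.2 : ℤ) + m.toInt ∧ d.2 ≤ y.length + 1

/-- States in which the head can leave the prefix for the first time. -/
def initialCrossing (A : TwoWayNFA α Q) (x : List α) : Set Q :=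
  {r | ∃ s ∈ A.start, ReflTransGen (A.PrefixStep x) (s, 0) (r, x.length + 1)}

/-- States in which the head can leave the prefix after entering it from the right in state `q`. -/
def prefixCrossing (A : TwoWayNFA α Q) (x : List α) (q : Q) : Set Q :=
  {r | ReflTransGen (A.PrefixStep x) (q, x.length) (r, x.length + 1)}

/-- States in which the head can leave the suffix to the left after entering it in state `r`. -/
def suffixCrossing (A : TwoWayNFA α Q) (y : List α) (r : Q) : Set Q :=
  {q | ReflTransGen (A.SuffixStep y) (r, 1) (q, 0)}

/-- States from which the automaton can accept without leaving the suffix. -/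
def acceptCrossing (A : TwoWayNFA α Q) (y : List α) : Set Q :=
  {r | ∃ f ∈ A.accept, ReflTransGen (A.SuffixStep y) (r, 1) (f, y.length + 1)}

theorem delimitedTape_append (x y : List α) :
    delimitedTape (x ++ y) = (TapeSymbol.leftEnd :: x.map TapeSymbol.letter) ++
      (y.map TapeSymbol.letter ++ [TapeSymbol.rightEnd]) := by
  simp [delimitedTape]

theorem PrefixStep.le_length {A : TwoWayNFA α Q} {x : List α} {c d : Q × ℕ}
    (h : A.PrefixStep x c d) : c.2 ≤ x.length := by
  obtain ⟨a, m, ha, -⟩ := h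
  obtain ⟨hlt, -⟩ := List.getElem?_eq_some_iff.1 ha
  simpa [Nat.lt_succ_iff] using hlt

theorem PrefixStep.next_le {A : TwoWayNFA α Q} {x : List α} {c d : Q × ℕ}
    (h : A.PrefixStep x c d) : d.2 ≤ c.2 + 1 := by
  obtain ⟨a, m, -, -, hd⟩ := h
  have := HeadMove.toInt_le_one m
  omega

theorem PrefixStep.stepRel {A : TwoWayNFA α Q} {x : List α} {c d : Q × ℕ}
    (h : A.PrefixStep x c d) (y : List α) : A.StepRel (x ++ y) c d := by
  have h1 := h.le_length
  have h2 := h.next_le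
  obtain ⟨a, m, ha, hm, hd⟩ := h
  refine ⟨a, m, ?_, hm, hd, by rw [List.length_append]; omega⟩
  rw [delimitedTape_append, List.getElem?_append_left (by simp; omega), ha]

theorem StepRel.prefixStep {A : TwoWayNFA α Q} {x y : List α} {c d : Q × ℕ}
    (h : A.StepRel (x ++ y) c d) (hc : c.2 ≤ x.length) : A.PrefixStep x c d := by
  obtain ⟨a, m, ha, hm, hd, -⟩ := h
  refine ⟨a, m, ?_, hm, hd⟩
  rwa [delimitedTape_append, List.getElem?_append_left (by simp; omega)] at ha

theorem SuffixStep.stepRel {A : TwoWayNFA α Q} {y : List α} {c d : Q × ℕ}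
    (h : A.SuffixStep y c d) (x : List α) :
    A.StepRel (x ++ y) (c.1, x.length + c.2) (d.1, x.length + d.2) := by
  obtain ⟨p, a, m, hp, ha, hm, hd, hle⟩ := h
  refine ⟨a, m, ?_, hm, by push_cast; omega, by simp only [List.length_append]; omega⟩
  rw [delimitedTape_append, List.getElem?_append_right (by simp; omega), ← ha]
  congr 1
  simp
  omega

theorem StepRel.suffixStep {A : TwoWayNFA α Q} {x y : List α} {p : Q} {k : ℕ} {d : Q × ℕ}
    (h : A.StepRel (x ++ y) (p, x.length + (k + 1)) d) :
    ∃ j, d.2 = x.length + j ∧ A.SuffixStep y (p, k + 1) (d.1, j) := by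
  obtain ⟨a, m, ha, hm, hd, hle⟩ := h
  have := HeadMove.neg_one_le_toInt m
  rw [List.length_append] at hle
  dsimp only at hd
  push_cast at hd
  refine ⟨d.2 - x.length, by omega, k, a, m, rfl, ?_, hm, ?_, ?_⟩
  · dsimp only at ha
    rw [delimitedTape_append, List.getElem?_append_right (by simp)] at ha
    rw [← ha]
    congr 1
    simp
    omega
  · dsimp only
    push_cast
    omega
  · dsimp only
    omega

theorem reflTransGen_stepRel_of_prefixStep {A : TwoWayNFA α Q} {x : List α} {c d : Q × ℕ}
    (h : ReflTransGen (A.PrefixStep x) c d) (y : List α) :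
    ReflTransGen (A.StepRel (x ++ y)) c d :=
  ReflTransGen.mono (fun _ _ h => h.stepRel y) _ _ h

theorem reflTransGen_stepRel_of_suffixStep {A : TwoWayNFA α Q} {y : List α} {c d : Q × ℕ}
    (h : ReflTransGen (A.SuffixStep y) c d) (x : List α) :
    ReflTransGen (A.StepRel (x ++ y)) (c.1, x.length + c.2) (d.1, x.length + d.2) :=
  h.lift (fun c => (c.1, x.length + c.2)) fun _ _ h => h.stepRel x

/-- Take the state `q` just before a first crossing: it is reached from a start state at the last
position of the prefix, so every exit from there is itself an initial crossing. -/
theorem exists_prefixCrossing_subset (A : TwoWayNFA α Q) (x : List α)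
    (h : (A.initialCrossing x).Nonempty) :
    ∃ q, A.prefixCrossing x q ⊆ A.initialCrossing x := by
  obtain ⟨r, s, hs, hr⟩ := h
  rcases hr.cases_tail with heq | ⟨⟨q, k⟩, hsq, hstep⟩
  · simp at heq
  · have h1 : k ≤ x.length := hstep.le_length
    have h2 : x.length + 1 ≤ k + 1 := hstep.next_le
    obtain rfl : k = x.length := by omega
    exact ⟨q, fun r' hr' => ⟨s, hs, hsq.trans hr'⟩⟩

theorem reachable_of_mem_crossingLayer (A : TwoWayNFA α Q) (x y : List α) {M : ℕ} {r : Q}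
    (h : r ∈ crossingLayer (A.initialCrossing x) (A.prefixCrossing x) (A.suffixCrossing y) M) :
    ∃ s ∈ A.start, ReflTransGen (A.StepRel (x ++ y)) (s, 0) (r, x.length + 1) := by
  have hinit : ∀ r ∈ A.initialCrossing x,
      ∃ s ∈ A.start, ReflTransGen (A.StepRel (x ++ y)) (s, 0) (r, x.length + 1) :=
    fun r ⟨s, hs, hr⟩ => ⟨s, hs, reflTransGen_stepRel_of_prefixStep hr y⟩
  induction M generalizing r with
  | zero => exact hinit r h
  | succ M ih =>
    rcases h with h | ⟨q, ⟨p, hp, hq⟩, hr⟩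
    · exact hinit r h
    · obtain ⟨s, hs, hsp⟩ := ih hp
      exact ⟨s, hs, (hsp.trans (reflTransGen_stepRel_of_suffixStep hq x)).trans
        (reflTransGen_stepRel_of_prefixStep hr y)⟩

/-- Every reachable configuration is reached by a last excursion into the prefix or the suffix. -/
theorem exists_last_excursion (A : TwoWayNFA α Q) (x y : List α) {s : Q} (hs : s ∈ A.start)
    {c : Q × ℕ} (h : ReflTransGen (A.StepRel (x ++ y)) (s, 0) c) :
    (c.2 ≤ x.length ∧ (ReflTransGen (A.PrefixStep x) (s, 0) c ∨
      ∃ M, ∃ p ∈ crossingLayer (A.initialCrossing x) (A.prefixCrossing x) (A.suffixCrossing y) M,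
        ∃ q ∈ A.suffixCrossing y p, ReflTransGen (A.PrefixStep x) (q, x.length) c)) ∨
    ∃ k, c.2 = x.length + (k + 1) ∧
      ∃ M, ∃ r ∈ crossingLayer (A.initialCrossing x) (A.prefixCrossing x) (A.suffixCrossing y) M,
        ReflTransGen (A.SuffixStep y) (r, 1) (c.1, k + 1) := by
  induction h with
  | refl => exact Or.inl ⟨Nat.zero_le _, Or.inl .refl⟩
  | @tail c d _ hstep ih =>
    rcases ih with ⟨hc, hreach⟩ | ⟨k, hk, M, r, hr, hreach⟩
    · have hp := hstep.prefixStep hc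
      by_cases hd : d.2 ≤ x.length
      · refine Or.inl ⟨hd, hreach.imp (·.tail hp) ?_⟩
        rintro ⟨M, p, hpM, q, hq, hqc⟩
        exact ⟨M, p, hpM, q, hq, hqc.tail hp⟩
      · have hd2 : d.2 = x.length + 1 := by
          have := hp.next_le
          omega
        have hdeq : d = (d.1, x.length + 1) := Prod.ext rfl hd2
        rw [hdeq] at hp
        refine Or.inr ⟨0, hd2, ?_⟩
        rcases hreach with hreach | ⟨M, p, hpM, q, hq, hqc⟩
        · exact ⟨0, d.1, ⟨s, hs, hreach.tail hp⟩, .refl⟩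
        · exact ⟨M + 1, d.1, Or.inr ⟨q, ⟨p, hpM, hq⟩, hqc.tail hp⟩, .refl⟩
    · have hceq : c = (c.1, x.length + (k + 1)) := Prod.ext rfl hk
      rw [hceq] at hstep
      obtain ⟨j, hj, hsuf⟩ := hstep.suffixStep
      -- Suffix position `0` is the last position of the prefix side, where a new prefix excursion
      -- starts.
      rcases j with _ | j
      · have hdeq : d = (d.1, x.length) := Prod.ext rfl hj
        exact Or.inl ⟨hj.le, Or.inr ⟨M, r, hr, d.1, hreach.tail hsuf, hdeq ▸ .refl⟩⟩
      · exact Or.inr ⟨j, hj, M, r, hr, hreach.tail hsuf⟩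

theorem exists_accepting_run_iff (A : TwoWayNFA α Q) (x y : List α) :
    (∃ s ∈ A.start, ∃ f ∈ A.accept,
      ReflTransGen (A.StepRel (x ++ y)) (s, 0) (f, (x ++ y).length + 1)) ↔
    ∃ M, ∃ r ∈ crossingLayer (A.initialCrossing x) (A.prefixCrossing x) (A.suffixCrossing y) M,
      r ∈ A.acceptCrossing y := by
  constructor
  · rintro ⟨s, hs, f, hf, h⟩
    rcases exists_last_excursion A x y hs h with ⟨hle, -⟩ | ⟨k, hk, M, r, hr, hreach⟩
    · simp only [List.length_append] at hle
      omega
    · simp only [List.length_append] at hk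
      obtain rfl : k = y.length := by omega
      exact ⟨M, r, hr, f, hf, hreach⟩
  · rintro ⟨M, r, hr, f, hf, hreach⟩
    obtain ⟨s, hs, hsr⟩ := reachable_of_mem_crossingLayer A x y hr
    refine ⟨s, hs, f, hf, ?_⟩
    have := hsr.trans (reflTransGen_stepRel_of_suffixStep hreach x)
    rwa [List.length_append, add_assoc]

theorem exists_sequence_of_reflTransGen {β : Type*} {r : β → β → Prop} {a b : β}
    (h : ReflTransGen r a b) : ∃ (t : ℕ) (c : Fin (t + 1) → β), c 0 = a ∧ c (Fin.last t) = b ∧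
      ∀ i : Fin t, r (c i.castSucc) (c i.succ) := by
  induction h with
  | refl => exact ⟨0, fun _ => a, rfl, rfl, fun i => i.elim0⟩
  | @tail b d _ hbd ih =>
    obtain ⟨t, c, h0, hl, hs⟩ := ih
    refine ⟨t + 1, Fin.snoc c d, ?_, Fin.snoc_last _ _, fun i => ?_⟩
    · rw [← Fin.castSucc_zero, Fin.snoc_castSucc, h0]
    · rw [Fin.snoc_castSucc]
      refine Fin.lastCases ?_ (fun i => ?_) i
      · rw [Fin.succ_last, Fin.snoc_last, hl]
        exact hbd
      · rw [Fin.succ_castSucc, Fin.snoc_castSucc]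
        exact hs i

theorem reflTransGen_of_sequence {β : Type*} {r : β → β → Prop} {t : ℕ} (c : Fin (t + 1) → β)
    (h : ∀ i : Fin t, r (c i.castSucc) (c i.succ)) : ReflTransGen r (c 0) (c (Fin.last t)) := by
  have : ∀ i : Fin (t + 1), ReflTransGen r (c 0) (c i) := by
    intro i
    induction i using Fin.induction with
    | zero => exact .refl
    | succ i ih => exact ih.tail (h i)
  exact this _

/-- This makes maximality automatic, so that acceptance reduces to reachability. -/
theorem not_stepRel_of_accept (A : TwoWayNFA α Q) (w : List α) {f : Q} (hf : f ∈ A.accept)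
    (d : Q × ℕ) : ¬ A.StepRel w (f, w.length + 1) d := by
  rintro ⟨a, m, ha, hm, -⟩
  obtain rfl : TapeSymbol.rightEnd = a := by
    simpa [delimitedTape, List.getElem?_append_right] using ha
  rw [A.step_accept f hf] at hm
  exact hm

theorem mem_language_iff (A : TwoWayNFA α Q) (w : List α) :
    w ∈ A.language ↔ ∃ s ∈ A.start, ∃ f ∈ A.accept,
      ReflTransGen (A.StepRel w) (s, 0) (f, w.length + 1) := by
  constructor
  · rintro ⟨t, c, hc⟩
    have h := reflTransGen_of_sequence c hc.step_rel
    have h0 : c 0 = ((c 0).1, 0) := Prod.ext rfl hc.start_pos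
    have hl : c (Fin.last t) = ((c (Fin.last t)).1, w.length + 1) := Prod.ext rfl hc.accept_pos
    rw [h0, hl] at h
    exact ⟨_, hc.start_mem, _, hc.accept_mem, h⟩
  · rintro ⟨s, hs, f, hf, h⟩
    obtain ⟨t, c, h0, hl, hstep⟩ := exists_sequence_of_reflTransGen h
    exact ⟨t, c, by rwa [h0], by rw [h0], hstep,
      fun d => by rw [hl]; exact A.not_stepRel_of_accept w hf d, by rwa [hl], by rw [hl]⟩

end TwoWayNFA

theorem mainTheorem2 {α Q : Type*} [Finite α] [Fintype Q] (n : ℕ) (hn : Fintype.card Q = n)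
    (A : TwoWayNFA α Q) (L : Language α) (hL : A.language = L) {l m : ℕ}
    (x : Fin l → List α) (y : Fin m → List α) :
    (concatMatrix L x y).rank ≤
      ∑ k ∈ Finset.Icc 1 n,
        (k - 1).factorial * k.factorial * Nat.stirlingSecond n k *
          Nat.stirlingSecond (n + 1) k := by
  classical
  subst hn hL
  refine le_trans (le_of_eq ?_) (rank_crossing_matrix_le (fun i => A.initialCrossing (x i))
    (fun i => A.prefixCrossing (x i)) (fun j => A.acceptCrossing (y j))
    (fun j => A.suffixCrossing (y j)) fun i => A.exists_prefixCrossing_subset (x i))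
  congr 1
  ext i j
  simp only [concatMatrix, Matrix.of_apply]
  exact if_congr ((A.mem_language_iff _).trans (A.exists_accepting_run_iff _ _)) rfl rfl
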